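/- Let $p$ be a prime, $k$ a field of characteristic $p$, $G$ a finite group, $H \le G$ a subgroup and $P \le G$ a $p$-subgroup. All modules are finitely generated left modules. A $kG$-module is a $p$-permutation module if for every $p$-subgroup $Q \le G$ it has a $k$-basis permuted by $Q$; let ${}_{kG}\mathbf{triv}$ be the category of $p$-permutation $kG$-modules and all $kG$-homomorphisms, and $Ch^b({}_{kG}\mathbf{triv})$ its category of bounded chain complexes. The Brauer construction of a $kG$-module $V$ at a subgroup $Q\le G$ is the $kN_G(Q)$-module $V(Q) = V^Q / \sum_{R < Q} \operatorname{tr}_R^Q(V^R)$, where $\operatorname{tr}^Q_R(v)=\sum_{g\in[Q/R]} gv$; it is a functor (restrict a homomorphism to fixed points and pass to the quotient). For $x \in G$ put ${}^xH = xHx^{-1}$, and for a $kH$-module $M$ let ${}^xM$ be the $k[{}^xH]$-module $M$ with $y \in {}^xH$ acting as $x^{-1}yx$. Theorem. Induction is a functor ${}_{kH}\mathbf{triv} \to {}_{kG}\mathbf{triv}$, the Brauer construction at $P$ is a functor ${}_{kG}\mathbf{triv} \to {}_{kN_G(P)}\mathbf{triv}$, and for every set $[N_G(P)\backslash G/H]$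 of representatives of the double cosets there is an isomorphism of $kN_G(P)$-modules, natural in $M \in {}_{kH}\mathbf{triv}$, $$\left(\operatorname{Ind}_H^G M\right)(P) \;\cong\; \bigoplus_{\substack{x \in [N_G(P)\backslash G/H]\\ P \le {}^xH}} \operatorname{Ind}_{N_G(P)\cap {}^xH}^{N_G(P)}\big(({}^xM)(P)\big),$$ that is, an isomorphism of functors ${}_{kH}\mathbf{triv} \to {}_{kN_G(P)}\mathbf{triv}$. Here $({}^xM)(P)$ is a module for $N_{{}^xH}(P) = N_G(P) \cap {}^xH$. Applied in each degree, it gives an isomorphism of the corresponding functors $Ch^b({}_{kH}\mathbf{triv}) \to Ch^b({}_{kN_G(P)}\mathbf{triv})$; in particular the formula holds, naturally, for bounded chain complexes of $p$-permutation modules. -/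

import Mathlib

open CategoryTheory

universe w w' u v v'

noncomputable section

namespace BrauerInd

section Representation

variable {k : Type u} {G : Type v} [CommRing k] [Group G] {V : Type w} [AddCommGroup V]
  [Module k V]

/-- The fixed points `V^Q` of a subgroup `Q ≤ G`. -/
abbrev fixed (ρ : Representation k G V) (Q : Subgroup G) : Submodule k V :=
  Representation.invariants (ρ.comp Q.subtype)

theorem mem_fixed (ρ : Representation k G V) (Q : Subgroup G) (v : V) :
    v ∈ fixed ρ Q ↔ ∀ g ∈ Q, ρ g v = v := by
  simp [fixed]

/-- On `V^Q`, the action of `g ∈ P` only depends on the coset `gQ`. -/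
theorem out_apply (ρ : Representation k G V) {Q P : Subgroup G} {v : V} (hv : v ∈ fixed ρ Q)
    (g : P) : ρ ((Quotient.out (g : P ⧸ Q.subgroupOf P) : P) : G) v = ρ (g : G) v := by
  obtain ⟨h, hh⟩ := QuotientGroup.mk_out_eq_mul (Q.subgroupOf P) g
  rw [hh]
  have h2 := (mem_fixed ρ Q v).1 hv _ (Subgroup.mem_subgroupOf.1 h.2)
  simp [h2]

/-- The endomorphism `∑_{g ∈ [P/Q]} g` of `V`, for a choice of coset representatives. -/
def cosetSum (ρ : Representation k G V) (Q P : Subgroup G) : V →ₗ[k] V :=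
  ∑ᶠ q : P ⧸ Q.subgroupOf P, ρ ((Quotient.out q : P) : G)

theorem cosetSum_apply [Finite G] (ρ : Representation k G V) (Q P : Subgroup G) (v : V) :
    cosetSum ρ Q P v = ∑ᶠ q : P ⧸ Q.subgroupOf P, ρ ((Quotient.out q : P) : G) v := by
  have := Fintype.ofFinite (P ⧸ Q.subgroupOf P)
  simp [cosetSum, finsum_eq_sum_of_fintype]

theorem cosetSum_mem [Finite G] (ρ : Representation k G V) (Q P : Subgroup G) (v : V) (hv : v ∈ fixed ρ Q) :
    cosetSum ρ Q P v ∈ fixed ρ P := by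
  rw [mem_fixed]
  intro g hg
  have := Fintype.ofFinite (P ⧸ Q.subgroupOf P)
  rw [cosetSum_apply, finsum_eq_sum_of_fintype, map_sum]
  refine Fintype.sum_equiv (MulAction.toPerm (⟨g, hg⟩ : P)) _ _ fun q => ?_
  induction q using QuotientGroup.induction_on with
  | H z =>
    rw [MulAction.toPerm_apply, MulAction.Quotient.smul_coe, out_apply ρ hv, out_apply ρ hv]
    simp

/-- The relative trace map `tr_Q^P : V^Q → V^P`, `v ↦ ∑_{g ∈ [P/Q]} g v`. -/
def relTrace [Finite G] (ρ : Representation k G V) (Q P : Subgroup G) : fixed ρ Q →ₗ[k] fixed ρ P :=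
  (cosetSum ρ Q P).restrict (cosetSum_mem ρ Q P)

/-- The submodule `∑_{Q < P} tr_Q^P (V^Q)` of `V^P`. -/
def traceSum [Finite G] (ρ : Representation k G V) (P : Subgroup G) : Submodule k (fixed ρ P) :=
  ⨆ (Q : Subgroup G) (_ : Q < P), LinearMap.range (relTrace ρ Q P)

/-- `V^P` as a representation of the normalizer `N_G(P)`. -/
def fixedRep (ρ : Representation k G V) (P : Subgroup G) :
    Representation k (Subgroup.normalizer (P : Set G)) (fixed ρ P) :=
  Representation.subrepresentation (ρ.comp (Subgroup.normalizer (P : Set G)).subtype) (fixed ρ P) (by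
    intro n v hv
    rw [Submodule.mem_comap, mem_fixed]
    intro g hg
    have h1 := (mem_fixed ρ P v).1 hv _ ((Subgroup.mem_set_normalizer_iff''.1 n.2 g).1 hg)
    change ρ g (ρ n v) = ρ n v
    have h2 : ρ g (ρ n v) = ρ n (ρ ((n : G)⁻¹ * g * n) v) := by
      rw [← Module.End.mul_apply, ← Module.End.mul_apply, ← map_mul, ← map_mul]
      simp [mul_assoc]
    rw [h2, h1])

theorem fixedRep_coe (ρ : Representation k G V) (P : Subgroup G)
    (n : Subgroup.normalizer (P : Set G)) (v : fixed ρ P) :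
    (fixedRep ρ P n v : V) = ρ (n : G) (v : V) := rfl

/-- `n tr_Q^P (v) = tr_{nQn⁻¹}^P (n v)` for `n ∈ N_G(P)`, so the sum of traces is stable under
`N_G(P)`. -/
theorem traceSum_le_comap [Finite G] (ρ : Representation k G V) (P : Subgroup G)
    (n : Subgroup.normalizer (P : Set G)) :
    traceSum ρ P ≤ (traceSum ρ P).comap (fixedRep ρ P n) := by
  refine iSup₂_le fun Q hQ => ?_
  rintro _ ⟨v, rfl⟩
  rw [Submodule.mem_comap]
  let c := MulAut.conj (n : G)
  have hP : P.map c.toMonoidHom = P := Subgroup.mem_normalizer_iff_map_conj_eq.1 n.2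
  let Q' : Subgroup G := Q.map c.toMonoidHom
  have hQ' : Q' < P := by
    rw [← hP]
    exact (Subgroup.map_lt_map_iff_of_injective c.injective).2 hQ
  have hv' : ρ (n : G) (v : V) ∈ fixed ρ Q' := by
    rw [mem_fixed]
    rintro _ ⟨g, hg, rfl⟩
    have h1 := (mem_fixed ρ Q _).1 v.2 g hg
    have h2 : ρ (c g) (ρ (n : G) (v : V)) = ρ (n : G) (ρ g v) := by
      simp only [← Module.End.mul_apply, ← map_mul]
      simp [c]
    simpa [h1] using h2
  refine Submodule.mem_iSup_of_mem Q' (Submodule.mem_iSup_of_mem hQ' ⟨⟨_, hv'⟩, ?_⟩)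
  apply Subtype.ext
  rw [fixedRep_coe]
  change cosetSum ρ Q' P (ρ (n : G) (v : V)) = ρ (n : G) (cosetSum ρ Q P v)
  have := Fintype.ofFinite (P ⧸ Q.subgroupOf P)
  have := Fintype.ofFinite (P ⧸ Q'.subgroupOf P)
  rw [cosetSum_apply, cosetSum_apply, finsum_eq_sum_of_fintype, finsum_eq_sum_of_fintype, map_sum]
  symm
  let e : P ≃* P := (c.subgroupMap P).trans (MulEquiv.subgroupCongr hP)
  have he : ∀ z : P, ((e z : P) : G) = n * z * (n : G)⁻¹ := fun z => rfl
  have hmap : (Q.subgroupOf P).map e.toMonoidHom = Q'.subgroupOf P := by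
    ext z
    simp only [Subgroup.mem_map, Subgroup.mem_subgroupOf, Q']
    constructor
    · rintro ⟨y, hy, rfl⟩
      exact ⟨_, hy, rfl⟩
    · rintro ⟨y, hy, hyz⟩
      refine ⟨⟨y, hQ.le hy⟩, hy, Subtype.ext ?_⟩
      exact hyz
  let E : P ⧸ Q.subgroupOf P ≃ P ⧸ Q'.subgroupOf P :=
    Quotient.congr e.toEquiv (by
      intro a b
      change QuotientGroup.leftRel _ a b ↔ QuotientGroup.leftRel _ (e a) (e b)
      rw [QuotientGroup.leftRel_apply, QuotientGroup.leftRel_apply, ← hmap, ← map_inv, ← map_mul]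
      exact (Subgroup.mem_map_iff_mem (f := e.toMonoidHom) e.injective).symm)
  refine Fintype.sum_equiv E _ _ fun q => ?_
  induction q using QuotientGroup.induction_on with
  | H z =>
    change _ = ρ ((Quotient.out ((e z : P) : P ⧸ Q'.subgroupOf P) : P) : G) _
    rw [out_apply ρ hv', out_apply ρ v.2, he]
    simp only [← Module.End.mul_apply, ← map_mul]
    simp

/-- The Brauer construction `V(P) = V^P / ∑_{Q < P} tr_Q^P (V^Q)`, as a representation of
`N_G(P)`. -/
def brauerRep [Finite G] (ρ : Representation k G V) (P : Subgroup G) :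
    Representation k (Subgroup.normalizer (P : Set G)) (fixed ρ P ⧸ traceSum ρ P) :=
  (fixedRep ρ P).quotient (traceSum ρ P) (traceSum_le_comap ρ P)

variable {W : Type w} [AddCommGroup W] [Module k W]

theorem map_mem_fixed {ρ : Representation k G V} {σ : Representation k G W}
    (f : ρ.IntertwiningMap σ) (Q : Subgroup G) (v : V) (hv : v ∈ fixed ρ Q) :
    f.toLinearMap v ∈ fixed σ Q := by
  rw [mem_fixed] at hv ⊢
  intro g hg
  have := congrArg (fun l => l v) (f.isIntertwining' g)
  simp only [LinearMap.comp_apply, hv g hg] at this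
  exact this.symm

theorem map_traceSum [Finite G] {ρ : Representation k G V} {σ : Representation k G W}
    (f : ρ.IntertwiningMap σ) (P : Subgroup G) :
    traceSum ρ P ≤ (traceSum σ P).comap (f.toLinearMap.restrict (map_mem_fixed f P)) := by
  refine iSup₂_le fun Q hQ => ?_
  rintro _ ⟨v, rfl⟩
  rw [Submodule.mem_comap]
  refine Submodule.mem_iSup_of_mem Q (Submodule.mem_iSup_of_mem hQ
    ⟨⟨_, map_mem_fixed f Q v v.2⟩, Subtype.ext ?_⟩)
  change cosetSum σ Q P (f.toLinearMap v) = f.toLinearMap (cosetSum ρ Q P v)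
  have := Fintype.ofFinite (P ⧸ Q.subgroupOf P)
  rw [cosetSum_apply, cosetSum_apply, finsum_eq_sum_of_fintype, finsum_eq_sum_of_fintype, map_sum]
  refine Finset.sum_congr rfl fun q _ => ?_
  exact (congrArg (fun l => l (v : V)) (f.isIntertwining' ((Quotient.out q : P) : G))).symm

/-- The Brauer construction on a homomorphism `f`: restrict `f` to `P`-fixed points and pass to
the quotients. -/
def brauerMap [Finite G] {ρ : Representation k G V} {σ : Representation k G W}
    (f : ρ.IntertwiningMap σ) (P : Subgroup G) :
    (brauerRep ρ P).IntertwiningMap (brauerRep σ P) where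
  toLinearMap := Submodule.mapQ _ _ (f.toLinearMap.restrict (map_mem_fixed f P)) (map_traceSum f P)
  isIntertwining' n := by
    apply Submodule.linearMap_qext
    ext v
    change Submodule.Quotient.mk _ = Submodule.Quotient.mk _
    congr 1
    apply Subtype.ext
    exact congrArg (fun l => l (v : V)) (f.isIntertwining' (n : G))

end Representation

section Functors

variable {k : Type u} {G : Type v} [CommRing k] [Group G]

/-- The Brauer construction at `P` as a functor from `kG`-modules to `kN_G(P)`-modules. -/
def brauerFunctor [Finite G] (P : Subgroup G) :
    Rep.{w} k G ⥤ Rep.{w} k (Subgroup.normalizer (P : Set G)) where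
  obj M := Rep.of (brauerRep M.ρ P)
  map f := Rep.ofHom (brauerMap f.hom P)
  map_id M := by
    apply Rep.hom_ext
    apply Representation.IntertwiningMap.ext
    apply Submodule.linearMap_qext
    rfl
  map_comp f g := by
    apply Rep.hom_ext
    apply Representation.IntertwiningMap.ext
    apply Submodule.linearMap_qext
    rfl

instance brauerFunctor_additive [Finite G] (P : Subgroup G) :
    (brauerFunctor.{w} (k := k) P).Additive where
  map_add {M N f g} := by
    apply Rep.hom_ext
    apply Representation.IntertwiningMap.ext
    apply Submodule.linearMap_qext
    rfl

instance indFunctor_additive {G' : Type v'} [Group G'] (φ : G →* G') :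
    (Rep.indFunctor.{w} k φ).Additive where
  map_add {M N f g} := by
    apply Rep.hom_ext
    apply Representation.IntertwiningMap.ext
    apply Representation.IndV.hom_ext
    intro h
    ext a
    change Representation.IndV.mk φ N.ρ h (f.hom a + g.hom a) =
      Representation.IndV.mk φ N.ρ h (f.hom a) + Representation.IndV.mk φ N.ρ h (g.hom a)
    rw [map_add]

open Classical in
/-- The direct sum of a family of functors with values in `kG`-modules. -/
def directSumFunctor {C : Type*} [Category C] {ι : Type v'} (F : ι → C ⥤ Rep.{w} k G) :
    C ⥤ Rep.{max v' w} k G where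
  obj M := Rep.of (Representation.directSum fun i => ((F i).obj M).ρ)
  map f := Rep.ofHom
    { toLinearMap := DirectSum.lmap fun i => ((F i).map f).hom.toLinearMap
      isIntertwining' := fun g => by
        ext i x : 2
        simp only [LinearMap.comp_apply, Representation.directSum_apply, DirectSum.lmap_lof]
        exact congrArg _ (congrArg (fun l => l x) (((F i).map f).hom.isIntertwining' g)) }
  map_id M := by
    apply Rep.hom_ext
    apply Representation.IntertwiningMap.ext
    ext i x : 2
    simp
  map_comp f g := by
    apply Rep.hom_ext
    apply Representation.IntertwiningMap.ext
    ext i x : 2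
    simp [DirectSum.lmap_lof]

instance directSumFunctor_additive {C : Type*} [Category C] [Preadditive C] {ι : Type v'}
    (F : ι → C ⥤ Rep.{w} k G) [∀ i, (F i).Additive] : (directSumFunctor F).Additive where
  map_add {M N f g} := by
    classical
    apply Rep.hom_ext
    apply Representation.IntertwiningMap.ext
    apply DirectSum.linearMap_ext
    intro i
    ext x
    change DirectSum.lmap (fun i => ((F i).map (f + g)).hom.toLinearMap)
        (DirectSum.lof k ι (fun i => (F i).obj M) i x) =
      DirectSum.lmap (fun i => ((F i).map f).hom.toLinearMap) (DirectSum.lof k ι _ i x) +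
        DirectSum.lmap (fun i => ((F i).map g).hom.toLinearMap) (DirectSum.lof k ι _ i x)
    rw [DirectSum.lmap_lof, DirectSum.lmap_lof, DirectSum.lmap_lof, ← map_add, Functor.map_add]
    rfl

end Functors

section Mackey

variable {k : Type u} {G : Type v} [CommRing k] [Group G] [Finite G]

/-- The conjugate subgroup `ˣH = x H x⁻¹`. -/
abbrev conjSubgroup {G : Type v} [Group G] (x : G) (H : Subgroup G) : Subgroup G :=
  H.map (MulAut.conj x).toMonoidHom

/-- The isomorphism `ˣH → H`, `y ↦ x⁻¹ y x`. -/
def unconj {G : Type v} [Group G] (x : G) (H : Subgroup G) : conjSubgroup x H →* H :=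
  ((MulAut.conj x).subgroupMap H).symm.toMonoidHom

theorem unconj_coe {G : Type v} [Group G] (x : G) (H : Subgroup G) (y : conjSubgroup x H) :
    (unconj x H y : G) = x⁻¹ * y * x := by
  obtain ⟨h, rfl⟩ := ((MulAut.conj x).subgroupMap H).surjective y
  have : unconj x H ((MulAut.conj x).subgroupMap H h) = h :=
    ((MulAut.conj x).subgroupMap H).symm_apply_apply h
  rw [this]
  simp [mul_assoc]

/-- The functor `M ↦ ˣM` from `kH`-modules to `k[ˣH]`-modules: `ˣM` is `M` on which `y ∈ ˣH` acts
as `x⁻¹ y x ∈ H`. -/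
abbrev conjFunctor (k : Type u) [CommRing k] {G : Type v} [Group G] (x : G) (H : Subgroup G) :
    Rep.{w} k H ⥤ Rep.{w} k (conjSubgroup x H) :=
  Rep.resFunctor (unconj x H)

/-- For `K ≤ G`, the inclusion of `N_G(P) ∩ K`, as a subgroup of `N_G(P)`, into `N_K(P ∩ K)`. It
is used for `P ≤ K`; then `P ∩ K` is `P` and the inclusion is the equality `N_G(P) ∩ K = N_K(P)`. -/
def toNormalizer {G : Type v} [Group G] (P K : Subgroup G) :
    K.subgroupOf (Subgroup.normalizer (P : Set G)) →*
      Subgroup.normalizer ((P.subgroupOf K : Subgroup K) : Set K) where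
  toFun n := ⟨⟨((n : Subgroup.normalizer (P : Set G)) : G), Subgroup.mem_subgroupOf.1 n.2⟩,
    Subgroup.mem_normalizer_iff.2 fun h => by
      have := Subgroup.mem_normalizer_iff.1 (n : Subgroup.normalizer (P : Set G)).2 (h : G)
      simpa [Subgroup.mem_subgroupOf] using this⟩
  map_one' := rfl
  map_mul' _ _ := rfl

/-- The functor `M ↦ Ind_{N_G(P) ∩ ˣH}^{N_G(P)} ((ˣM)(P))` from `kH`-modules to
`kN_G(P)`-modules, used for `P ≤ ˣH`. -/
def mackeyTerm (k : Type u) [CommRing k] {G : Type v} [Group G] [Finite G]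
    (P H : Subgroup G) (x : G) :
    Rep.{w} k H ⥤ Rep.{max w u v} k (Subgroup.normalizer (P : Set G)) :=
  conjFunctor k x H ⋙ brauerFunctor (P.subgroupOf (conjSubgroup x H)) ⋙
    Rep.resFunctor (toNormalizer P (conjSubgroup x H)) ⋙
    Rep.indFunctor k ((conjSubgroup x H).subgroupOf (Subgroup.normalizer (P : Set G))).subtype

instance mackeyTerm_additive (P H : Subgroup G) (x : G) : (mackeyTerm.{w} k P H x).Additive := by
  unfold mackeyTerm
  infer_instance

/-- The double cosets `N_G(P) x H`. -/
abbrev NDoset {G : Type v} [Group G] (P H : Subgroup G) : Type v :=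
  DoubleCoset.Quotient ((Subgroup.normalizer (P : Set G) : Subgroup G) : Set G) (H : Set G)

/-- The direct sum of `Ind_{N_G(P) ∩ ˣH}^{N_G(P)} ((ˣM)(P))` over those `x` in a set of
representatives `s` of the double cosets `N_G(P) \ G / H` for which `P ≤ ˣH`. -/
def mackeySum (k : Type u) [CommRing k] {G : Type v} [Group G] [Finite G]
    (P H : Subgroup G) (s : NDoset P H → G) :
    Rep.{w} k H ⥤ Rep.{max w u v} k (Subgroup.normalizer (P : Set G)) :=
  directSumFunctor fun q : {q : NDoset P H // P ≤ conjSubgroup (s q) H} => mackeyTerm k P H (s q)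

instance mackeySum_additive (P H : Subgroup G) (s : NDoset P H → G) :
    (mackeySum.{w} k P H s).Additive := by
  unfold mackeySum
  infer_instance

end Mackey

section PPermutation

/-- A `p`-permutation `kG`-module: a finitely generated module which has, for every `p`-subgroup
`Q ≤ G`, a (finite) `k`-basis that is permuted by `Q`. -/
def isPPerm (p : ℕ) (k : Type u) (G : Type v) [CommRing k] [Group G] :
    ObjectProperty (Rep.{w} k G) := fun M =>
  ∀ Q : Subgroup G, IsPGroup p Q → ∃ (n : ℕ) (b : Module.Basis (Fin n) k M.V),
    ∀ g ∈ Q, ∀ i, ∃ j, M.ρ g (b i) = b j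

/-- The category of `p`-permutation `kG`-modules, a full subcategory of all `kG`-modules. -/
abbrev Triv (p : ℕ) (k : Type u) (G : Type v) [CommRing k] [Group G] : Type _ :=
  (isPPerm.{w} p k G).FullSubcategory

variable {p : ℕ} {k : Type u} [CommRing k] {G : Type v} [Group G] {G' : Type v'} [Group G']

/-- A functor that preserves `p`-permutation modules, as a functor between the categories of
`p`-permutation modules. -/
abbrev restrictTriv (F : Rep.{w} k G ⥤ Rep.{w'} k G')
    (hF : ∀ M, isPPerm p k G M → isPPerm p k G' (F.obj M)) : Triv.{w} p k G ⥤ Triv.{w'} p k G' :=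
  (isPPerm p k G').lift ((isPPerm p k G).ι ⋙ F) fun M => hF M.obj M.property

instance restrictTriv_additive (F : Rep.{w} k G ⥤ Rep.{w'} k G') [F.Additive]
    (hF : ∀ M, isPPerm p k G M → isPPerm p k G' (F.obj M)) : (restrictTriv F hF).Additive where
  map_add {M N f g} := by
    apply ObjectProperty.hom_ext
    exact F.map_add

end PPermutation

section Complexes

/-- Bounded chain complexes: all but finitely many terms are zero. -/
def isBounded (A : Type*) [Category A] [Preadditive A] : ObjectProperty (ChainComplex A ℤ) :=
  fun C => ∃ n : ℕ, ∀ i : ℤ, (n : ℤ) < |i| → Limits.IsZero (C.X i)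

/-- The category `Ch^b(A)` of bounded chain complexes. -/
abbrev Chb (A : Type*) [Category A] [Preadditive A] : Type _ := (isBounded A).FullSubcategory

/-- The functor `Ch^b(A) ⥤ Ch^b(B)` given by applying an additive functor termwise. -/
abbrev mapChb {A B : Type*} [Category A] [Preadditive A] [Category B] [Preadditive B]
    (F : A ⥤ B) [F.Additive] : Chb A ⥤ Chb B :=
  (isBounded B).lift ((isBounded A).ι ⋙ F.mapHomologicalComplex (ComplexShape.down ℤ))
    fun C => by
      obtain ⟨n, hn⟩ := C.property
      exact ⟨n, fun i hi => F.map_isZero (hn i hi)⟩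

end Complexes

end BrauerInd

end

open BrauerInd

noncomputable section

/-! As a module for `P`, `Ind_H^G V` is the direct sum of the summands `xH ⊗ V`, which `P` permutes
as it permutes `G/H`. In a `P`-fixed vector the components along one `P`-orbit add up to a relative
trace from a stabilizer. Modulo traces from proper subgroups only the cosets fixed by `P` survive,
and these are the `xH` with `P ≤ ˣH`. On such a summand `P` acts as on `ˣV`. The normalizer `N_G(P)`
permutes the fixed cosets, its orbits lie in the double cosets `N_G(P) x H`, and the stabilizer of
`xH` is `N_G(P) ∩ ˣH`, whence the sum of induced modules.

The isomorphism goes from the sum to `(Ind_H^G V)(P)` by `n ⊗ [v] ↦ n [x ⊗ v]`. Coefficient maps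
`indEval` also descend to Brauer quotients and recover every coefficient of the source, which gives
injectivity (`brauerIndEval_mackeySumHom`). Surjectivity is the orbit argument,
`mem_of_fixed_components`. Neither needs a prime: the isomorphism holds for all `kH`-modules, every
subgroup `P` and every commutative ring `k`.

The prime matters for staying among `p`-permutation modules. Induction preserves them by a choice of
bases adapted to orbits (`isPPerm_ind`). The Brauer construction preserves them because the
`P`-fixed members of a permuted basis give a basis of `V(P)`; independence uses that `p` divides `[P
: Q]` for `Q < P` (`isPPerm_brauer`). -/

namespace BrauerInd

/-! ### Induced modules as sums over cosets: generators and coefficients -/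

section Induction

variable {k : Type u} {G : Type v} [CommRing k] [Group G] {K : Subgroup G} {V : Type w}
  [AddCommGroup V] [Module k V] (ρ : Representation k K V)

/-- The map `v ↦ x ⊗ v` from `V` to `Ind_K^G V`. -/
def indMk (x : G) : V →ₗ[k] Representation.IndV K.subtype ρ :=
  -- In `IndV` an element `g` sends the generator at `y` to the one at `y * g⁻¹`; the inverse turns
  -- this into left multiplication on `x`.
  Representation.IndV.mk K.subtype ρ x⁻¹

theorem ind_indMk (g x : G) (v : V) :
    Representation.ind K.subtype ρ g (indMk ρ x v) = indMk ρ (g * x) v := by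
  simp [indMk]

/-- This is the coinvariance relation for `h` at `(x * h)⁻¹ ⊗ v`, as `h * (x * h)⁻¹ = x⁻¹`. -/
theorem indMk_mul (x : G) (h : K) (v : V) : indMk ρ (x * h) v = indMk ρ x (ρ h v) := by
  have := Representation.Coinvariants.mk_self_apply
    (Representation.tprod ((Representation.leftRegular k G).comp K.subtype) ρ) h
    (TensorProduct.tmul k (MonoidAlgebra.single (x * h)⁻¹ 1) v)
  rw [indMk, indMk]
  simp only [Representation.IndV.mk, LinearMap.comp_apply, TensorProduct.mk_apply]
  rw [← this]
  simp

@[ext high]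
theorem ind_hom_ext {W : Type*} [AddCommGroup W] [Module k W]
    {f g : Representation.IndV K.subtype ρ →ₗ[k] W}
    (h : ∀ x : G, f ∘ₗ indMk ρ x = g ∘ₗ indMk ρ x) : f = g := by
  apply Representation.IndV.hom_ext
  intro x
  simpa [indMk] using h x⁻¹

/-- The linear map out of `Ind_K^G V` with prescribed values on `x ⊗ v`. -/
def indLift {W : Type*} [AddCommGroup W] [Module k W] (f : G → V →ₗ[k] W)
    (hf : ∀ (x : G) (h : K) (v : V), f (x * h) v = f x (ρ h v)) :
    Representation.IndV K.subtype ρ →ₗ[k] W :=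
  Representation.Coinvariants.lift _
    (TensorProduct.lift <| (Finsupp.lift _ _ _ fun y => f y⁻¹) ∘ₗ
      (MonoidAlgebra.coeffLinearEquiv k).toLinearMap) (by
    intro h
    ext y v
    simp only [LinearMap.coe_comp, Function.comp_apply, MonoidAlgebra.lsingle_apply]
    simp [← hf])

@[simp]
theorem indLift_indMk {W : Type*} [AddCommGroup W] [Module k W] (f : G → V →ₗ[k] W)
    (hf : ∀ (x : G) (h : K) (v : V), f (x * h) v = f x (ρ h v)) (x : G) (v : V) :
    indLift ρ f hf (indMk ρ x v) = f x v := by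
  simp [indLift, indMk]

open Classical in
/-- The coefficient at `x` of an element of `Ind_K^G V`; it sends `y ⊗ v` to `x⁻¹ y v` if
`y ∈ x K` and to zero otherwise. -/
def indEval (x : G) : Representation.IndV K.subtype ρ →ₗ[k] V :=
  indLift ρ (fun y => if h : x⁻¹ * y ∈ K then ρ ⟨x⁻¹ * y, h⟩ else 0) (by
    intro y h v
    by_cases hy : x⁻¹ * y ∈ K
    · have hy' : x⁻¹ * (y * h) ∈ K := by rw [← mul_assoc]; exact K.mul_mem hy h.2
      rw [dif_pos hy, dif_pos hy', ← Module.End.mul_apply, ← map_mul]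
      congr 2
      apply Subtype.ext
      simp [mul_assoc]
    · have hy' : ¬ x⁻¹ * (y * h) ∈ K := by
        rw [← mul_assoc]; exact fun h' => hy ((K.mul_mem_cancel_right h.2).1 h')
      rw [dif_neg hy, dif_neg hy']
      simp)

theorem indEval_indMk_of_mem {x y : G} (h : x⁻¹ * y ∈ K) (v : V) :
    indEval ρ x (indMk ρ y v) = ρ ⟨x⁻¹ * y, h⟩ v := by
  simp [indEval, h]

theorem indEval_indMk_of_notMem {x y : G} (h : x⁻¹ * y ∉ K) (v : V) :
    indEval ρ x (indMk ρ y v) = 0 := by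
  simp [indEval, h]

@[simp]
theorem indEval_indMk (x : G) (v : V) : indEval ρ x (indMk ρ x v) = v := by
  rw [indEval_indMk_of_mem ρ (by simp)]
  have : (⟨x⁻¹ * x, by simp⟩ : K) = 1 := Subtype.ext (by simp)
  rw [this]
  simp

theorem indEval_ind (g x : G) (v : Representation.IndV K.subtype ρ) :
    indEval ρ x (Representation.ind K.subtype ρ g v) = indEval ρ (g⁻¹ * x) v := by
  revert v
  refine LinearMap.congr_fun (f := indEval ρ x ∘ₗ Representation.ind K.subtype ρ g) ?_
  ext y v
  simp only [LinearMap.comp_apply, ind_indMk]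
  have e : x⁻¹ * (g * y) = (g⁻¹ * x)⁻¹ * y := by group
  by_cases h : x⁻¹ * (g * y) ∈ K
  · rw [indEval_indMk_of_mem ρ h, indEval_indMk_of_mem ρ (e ▸ h)]
    simp only [e]
  · rw [indEval_indMk_of_notMem ρ h, indEval_indMk_of_notMem ρ (e ▸ h)]

theorem indEval_mul (x : G) (h : K) (v : Representation.IndV K.subtype ρ) :
    indEval ρ (x * h) v = ρ h⁻¹ (indEval ρ x v) := by
  revert v
  refine LinearMap.congr_fun (g := ρ h⁻¹ ∘ₗ indEval ρ x) ?_
  ext y v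
  simp only [LinearMap.comp_apply]
  have e : (x * h)⁻¹ * y = (h : G)⁻¹ * (x⁻¹ * y) := by group
  by_cases hy : x⁻¹ * y ∈ K
  · have hy' : (x * h)⁻¹ * y ∈ K := by rw [e]; exact K.mul_mem (K.inv_mem h.2) hy
    rw [indEval_indMk_of_mem ρ hy, indEval_indMk_of_mem ρ hy', ← Module.End.mul_apply, ← map_mul]
    congr 2
    exact Subtype.ext e
  · have hy' : (x * h)⁻¹ * y ∉ K := by
      rw [e]; exact fun h' => hy ((K.mul_mem_cancel_left (K.inv_mem h.2)).1 h')
    rw [indEval_indMk_of_notMem ρ hy, indEval_indMk_of_notMem ρ hy', map_zero]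

/-- The factors `h` and `h⁻¹` from `indMk_mul` and `indEval_mul` cancel. Thus `indMk ρ x ∘ indEval ρ
x`, the projection onto the summand at `xK`, does not depend on the representative. -/
theorem indMk_indEval_congr {x y : G} (h : (x : G ⧸ K) = y)
    (v : Representation.IndV K.subtype ρ) :
    indMk ρ x (indEval ρ x v) = indMk ρ y (indEval ρ y v) := by
  obtain ⟨h, rfl⟩ : ∃ h : K, y = x * h := ⟨⟨x⁻¹ * y, QuotientGroup.eq.1 h⟩, by simp⟩
  rw [indMk_mul, indEval_mul, ← Module.End.mul_apply, ← map_mul]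
  simp

theorem sum_indMk_indEval [Fintype (G ⧸ K)] (t : G ⧸ K → G) (ht : ∀ c, (t c : G ⧸ K) = c)
    (v : Representation.IndV K.subtype ρ) :
    ∑ c, indMk ρ (t c) (indEval ρ (t c) v) = v := by
  have : ∑ c, indMk ρ (t c) ∘ₗ indEval ρ (t c) = LinearMap.id := by
    ext y v
    simp only [LinearMap.comp_apply, LinearMap.sum_apply, LinearMap.id_apply]
    rw [Finset.sum_eq_single (y : G ⧸ K), indMk_indEval_congr ρ (ht y), indEval_indMk]
    · intro c _ hc
      rw [indEval_indMk_of_notMem, map_zero]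
      intro h
      apply hc
      rw [← ht c]
      exact QuotientGroup.eq.2 h
    · simp
  simpa using LinearMap.congr_fun this v

/-- The decomposition `Ind_K^G V = ⨁_{c ∈ G/K} t_c ⊗ V` for coset representatives `t_c`. -/
def indEquivPi [Fintype (G ⧸ K)] (t : G ⧸ K → G) (ht : ∀ c, (t c : G ⧸ K) = c) :
    (G ⧸ K → V) ≃ₗ[k] Representation.IndV K.subtype ρ :=
  LinearEquiv.ofLinearMap (∑ c, indMk ρ (t c) ∘ₗ LinearMap.proj c)
    (LinearMap.pi fun c => indEval ρ (t c))
    (by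
      refine LinearMap.ext fun v => ?_
      simpa using sum_indMk_indEval ρ t ht v)
    (by
      classical
      ext c v d
      simp only [LinearMap.comp_apply, LinearMap.pi_apply, LinearMap.sum_apply, LinearMap.proj_apply,
        LinearMap.id_apply, map_sum, LinearMap.single_apply]
      rw [Finset.sum_eq_single d]
      · simp
      · intro c' _ hc'
        rw [indEval_indMk_of_notMem]
        intro h
        apply hc'
        rw [← ht c', ← ht d]
        exact (QuotientGroup.eq.2 h).symm
      · simp)

theorem indEquivPi_single [Fintype (G ⧸ K)] [DecidableEq (G ⧸ K)] (t : G ⧸ K → G)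
    (ht : ∀ c, (t c : G ⧸ K) = c) (c : G ⧸ K) (v : V) :
    indEquivPi ρ t ht (Pi.single c v) = indMk ρ (t c) v := by
  change (∑ c, indMk ρ (t c) ∘ₗ LinearMap.proj c) (Pi.single c v) = _
  simp only [LinearMap.sum_apply, LinearMap.comp_apply, LinearMap.proj_apply]
  rw [Finset.sum_eq_single c]
  · simp
  · intro d _ hd
    simp [hd]
  · simp

end Induction

/-! ### Fixed vectors modulo traces, and functoriality of the Brauer quotient along `P ≃ P'` -/

section Brauer

variable {k : Type u} {G : Type v} [CommRing k] [Group G] [Finite G] {V : Type w}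
  [AddCommGroup V] [Module k V] {G' : Type v'} [Group G'] [Finite G'] {W : Type w'}
  [AddCommGroup W] [Module k W]

/-- If `V` is the direct sum of submodules permuted by `P` with projections `e x`, then a
`P`-fixed vector is, modulo traces from proper subgroups, the sum of its components in the
summands that are stable under `P`. -/
theorem mem_of_fixed_components (ρ : Representation k G V) (P : Subgroup G) {X : Type*} [Finite X]
    [MulAction P X] (e : X → V → V)
    (he : ∀ (g : P) (x : X) (v : V), ρ g (e x v) = e (g • x) (ρ g v))
    (hsum : ∀ v, ∑ᶠ x, e x v = v) (R : Submodule k (fixed ρ P)) (hR : traceSum ρ P ≤ R)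
    (v : fixed ρ P)
    (h : ∀ x ∈ MulAction.fixedPoints P X, ∀ hx : e x v ∈ fixed ρ P, ⟨e x v, hx⟩ ∈ R) : v ∈ R := by
  classical
  have := Fintype.ofFinite X
  have := Fintype.ofFinite (MulAction.orbitRel.Quotient P X)
  have hev : ∀ (g : P) (x : X), ρ g (e x v) = e (g • x) v := fun g x => by
    rw [he, (mem_fixed ρ P v).1 v.2 g g.2]
  -- The orbit sum through `x` is the trace of `e x v` from the stabilizer `Q` of `x` in `P`. If `Q
  -- < P` it lies in `traceSum`; if `Q = P` the orbit is `{x}` and the hypothesis `h` applies.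
  have key : ∀ o : MulAction.orbitRel.Quotient P X, ∃ r ∈ R,
      (r : V) = ∑ x : {x : X // Quotient.mk (MulAction.orbitRel P X) x = o}, e x v := by
    intro o
    induction o using Quotient.inductionOn with
    | h x =>
      let Q : Subgroup G := (MulAction.stabilizer P x).map P.subtype
      have hQ : Q.subgroupOf P = MulAction.stabilizer P x :=
        Subgroup.comap_map_eq_self_of_injective P.subtype_injective _
      have hQP : Q ≤ P := Subgroup.map_subtype_le _
      have hx : e x v ∈ fixed ρ Q := by
        rw [mem_fixed]
        rintro _ ⟨g, hg, rfl⟩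
        exact (hev g x).trans (by rw [MulAction.mem_stabilizer_iff.1 hg])
      have := Fintype.ofFinite (P ⧸ Q.subgroupOf P)
      let E : P ⧸ Q.subgroupOf P →
          {y : X // Quotient.mk (MulAction.orbitRel P X) y = Quotient.mk _ x} :=
        fun q => ⟨(Quotient.out q : P) • x, Quotient.sound ⟨Quotient.out q, rfl⟩⟩
      have hE : Function.Bijective E := by
        constructor
        · intro a b hab
          have h1 : (Quotient.out a : P) • x = (Quotient.out b : P) • x := congrArg Subtype.val hab
          rw [← Quotient.out_eq a, ← Quotient.out_eq b]
          refine QuotientGroup.eq.2 ?_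
          rw [SetLike.ext_iff.1 hQ, MulAction.mem_stabilizer_iff, mul_smul, ← h1, inv_smul_smul]
        · rintro ⟨y, hy⟩
          obtain ⟨g, rfl⟩ := Quotient.exact hy
          refine ⟨(g : P ⧸ Q.subgroupOf P), Subtype.ext ?_⟩
          obtain ⟨m, hm⟩ := QuotientGroup.mk_out_eq_mul (Q.subgroupOf P) g
          change (Quotient.out (g : P ⧸ Q.subgroupOf P) : P) • x = g • x
          have hm' := (SetLike.ext_iff.1 hQ _).1 m.2
          rw [MulAction.mem_stabilizer_iff] at hm'
          rw [hm, mul_smul, hm']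
      have hs : cosetSum ρ Q P (e x v) =
          ∑ y : {y : X // Quotient.mk (MulAction.orbitRel P X) y = Quotient.mk _ x}, e y v := by
        rw [cosetSum_apply, finsum_eq_sum_of_fintype]
        exact Fintype.sum_bijective E hE _ _ fun q => hev _ _
      refine ⟨⟨_, cosetSum_mem ρ Q P _ hx⟩, ?_, hs⟩
      rcases hQP.lt_or_eq with hlt | heq
      · exact hR (Submodule.mem_iSup_of_mem Q (Submodule.mem_iSup_of_mem hlt ⟨⟨_, hx⟩, rfl⟩))
      · have hfix : x ∈ MulAction.fixedPoints P X := by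
          intro g
          rw [← MulAction.mem_stabilizer_iff, ← hQ, Subgroup.mem_subgroupOf, heq]
          exact g.2
        have hx' : e x v ∈ fixed ρ P := by simpa only [heq] using hx
        refine (congrArg (· ∈ R) (Subtype.ext (hs.trans ?_))).mpr (h x hfix hx')
        refine Finset.sum_eq_single_of_mem (⟨x, rfl⟩ : {y : X //
          Quotient.mk (MulAction.orbitRel P X) y = Quotient.mk _ x}) (Finset.mem_univ _) ?_
        rintro ⟨y, hy⟩ - hne
        exfalso
        apply hne
        obtain ⟨g, rfl⟩ := Quotient.exact hy
        exact Subtype.ext (hfix g)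
  choose r hr hr' using key
  have : v = ∑ o, r o := by
    apply Subtype.ext
    rw [Submodule.coe_sum, Finset.sum_congr rfl fun o _ => hr' o,
      Fintype.sum_fiberwise (fun x => (Quotient.mk (MulAction.orbitRel P X) x)) (fun x => e x v),
      ← finsum_eq_sum_of_fintype, hsum]
  rw [this]
  exact R.sum_mem fun o _ => hr o

variable (ρ : Representation k G V) (σ : Representation k G' W) (P : Subgroup G) (P' : Subgroup G')
  (α : P ≃* P') (f : V →ₗ[k] W) (hf : ∀ (g : P) (v : V), f (ρ g v) = σ (α g) (f v))

include hf

omit [Finite G] [Finite G'] in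
theorem semilinear_mem_fixed (v : V) (hv : v ∈ fixed ρ P) : f v ∈ fixed σ P' := by
  rw [mem_fixed] at hv ⊢
  intro g hg
  have := hf (α.symm ⟨g, hg⟩) v
  rw [hv _ (α.symm ⟨g, hg⟩).2] at this
  simpa using this.symm

/-- The map `f` carries a trace from `Q < P` to the trace from `α(Q) < P'`, because `α` matches the
cosets. This form serves to compare `P` inside `G` with `P` inside `ˣH`. -/
theorem semilinear_traceSum : traceSum ρ P ≤
    (traceSum σ P').comap (f.restrict (semilinear_mem_fixed ρ σ P P' α f hf)) := by
  refine iSup₂_le fun Q hQ => ?_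
  rintro _ ⟨v, rfl⟩
  rw [Submodule.mem_comap]
  let Q' : Subgroup G' := ((Q.subgroupOf P).map α.toMonoidHom).map P'.subtype
  have hQ'P : Q' ≤ P' := Subgroup.map_subtype_le _
  have hQ's : Q'.subgroupOf P' = (Q.subgroupOf P).map α.toMonoidHom :=
    Subgroup.comap_map_eq_self_of_injective P'.subtype_injective _
  have hQ' : Q' < P' := by
    refine lt_of_le_of_ne hQ'P fun h => hQ.not_ge fun g hg => ?_
    have h1 : α ⟨g, hg⟩ ∈ Q'.subgroupOf P' := by
      rw [Subgroup.mem_subgroupOf, h]; exact (α ⟨g, hg⟩).2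
    rw [hQ's] at h1
    exact (Subgroup.mem_map_iff_mem (f := α.toMonoidHom) α.injective).1 h1
  have hv' : f v ∈ fixed σ Q' := by
    rw [mem_fixed]
    rintro _ ⟨_, ⟨g, hg, rfl⟩, rfl⟩
    exact (hf g v).symm.trans (congrArg f ((mem_fixed ρ Q v).1 v.2 _ hg))
  refine Submodule.mem_iSup_of_mem Q' (Submodule.mem_iSup_of_mem hQ' ⟨⟨_, hv'⟩, ?_⟩)
  apply Subtype.ext
  change cosetSum σ Q' P' (f v) = f (cosetSum ρ Q P v)
  have := Fintype.ofFinite (P ⧸ Q.subgroupOf P)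
  have := Fintype.ofFinite (P' ⧸ Q'.subgroupOf P')
  rw [cosetSum_apply, cosetSum_apply, finsum_eq_sum_of_fintype, finsum_eq_sum_of_fintype, map_sum]
  symm
  let E : P ⧸ Q.subgroupOf P ≃ P' ⧸ Q'.subgroupOf P' :=
    Quotient.congr α.toEquiv (by
      intro a b
      change QuotientGroup.leftRel _ a b ↔ QuotientGroup.leftRel _ (α a) (α b)
      rw [QuotientGroup.leftRel_apply, QuotientGroup.leftRel_apply, hQ's, ← map_inv, ← map_mul]
      exact (Subgroup.mem_map_iff_mem (f := α.toMonoidHom) α.injective).symm)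
  refine Fintype.sum_equiv E _ _ fun q => ?_
  induction q using QuotientGroup.induction_on with
  | H z =>
    change _ = σ ((Quotient.out ((α z : P') : P' ⧸ Q'.subgroupOf P') : P') : G') _
    rw [out_apply σ hv', out_apply ρ v.2, hf]

/-- The map `V(P) → W(P')` induced by a linear map that is equivariant along `P ≃ P'`. -/
def brauerSemilinear : (fixed ρ P ⧸ traceSum ρ P) →ₗ[k] (fixed σ P' ⧸ traceSum σ P') :=
  Submodule.mapQ _ _ (f.restrict (semilinear_mem_fixed ρ σ P P' α f hf))
    (semilinear_traceSum ρ σ P P' α f hf)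

end Brauer

/-! ### The contribution of one double coset -/

section Mackey

variable {k : Type u} {G : Type v} [CommRing k] [Group G] [Finite G] (P H : Subgroup G) (x : G)
  {V : Type w} [AddCommGroup V] [Module k V] (ρ : Representation k H V)

/-- The representation `ˣV` of `ˣH` on `V`. -/
abbrev conjRep : Representation k (conjSubgroup x H) V := ρ.comp (unconj x H)

/-- The Brauer quotient `(ˣV)(P)` as a representation of `N_G(P) ∩ ˣH`. -/
abbrev conjBrauerRep :
    Representation k ((conjSubgroup x H).subgroupOf (Subgroup.normalizer (P : Set G)))
      (fixed (conjRep H x ρ) (P.subgroupOf (conjSubgroup x H)) ⧸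
        traceSum (conjRep H x ρ) (P.subgroupOf (conjSubgroup x H))) :=
  (brauerRep (conjRep H x ρ) (P.subgroupOf (conjSubgroup x H))).comp
    (toNormalizer P (conjSubgroup x H))

-- Since `g x = x (x⁻¹ g x)`, the slice `x ⊗ V` is a copy of `ˣV`. With `indEval_ind_conj` this is
-- the equivariance that lets `indMk` and `indEval` descend to Brauer quotients when `P ≤ ˣH`.
omit [Finite G] in
theorem ind_indMk_conj (g : conjSubgroup x H) (v : V) :
    Representation.ind H.subtype ρ (g : G) (indMk ρ x v) = indMk ρ x (conjRep H x ρ g v) := by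
  rw [ind_indMk]
  change _ = indMk ρ x (ρ (unconj x H g) v)
  rw [← indMk_mul, unconj_coe]
  congr 2
  group

omit [Finite G] in
theorem indEval_ind_conj (g : conjSubgroup x H) (v : Representation.IndV H.subtype ρ) :
    indEval ρ x (Representation.ind H.subtype ρ (g : G) v) = conjRep H x ρ g (indEval ρ x v) := by
  rw [indEval_ind]
  change _ = ρ (unconj x H g) _
  have : (g : G)⁻¹ * x = x * ((unconj x H g)⁻¹ : H) := by
    rw [Subgroup.coe_inv, unconj_coe]; group
  rw [this, indEval_mul, inv_inv]

variable {P H x} (hx : P ≤ conjSubgroup x H)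

/-- The map `(ˣV)(P) → (Ind_H^G V)(P)`, `[v] ↦ [x ⊗ v]`. -/
def brauerIndMk :
    (fixed (conjRep H x ρ) (P.subgroupOf (conjSubgroup x H)) ⧸
        traceSum (conjRep H x ρ) (P.subgroupOf (conjSubgroup x H))) →ₗ[k]
      (fixed (Representation.ind H.subtype ρ) P ⧸ traceSum (Representation.ind H.subtype ρ) P) :=
  brauerSemilinear _ _ _ _ (Subgroup.subgroupOfEquivOfLe hx) (indMk ρ x) fun g v =>
    (ind_indMk_conj H x ρ g v).symm

/-- The map `(Ind_H^G V)(P) → (ˣV)(P)` that takes the coefficient at `x`. -/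
def brauerIndEval :
    (fixed (Representation.ind H.subtype ρ) P ⧸ traceSum (Representation.ind H.subtype ρ) P) →ₗ[k]
    (fixed (conjRep H x ρ) (P.subgroupOf (conjSubgroup x H)) ⧸
        traceSum (conjRep H x ρ) (P.subgroupOf (conjSubgroup x H))) :=
  brauerSemilinear _ _ _ _ (Subgroup.subgroupOfEquivOfLe hx).symm (indEval ρ x) fun g v =>
    indEval_ind_conj H x ρ ⟨g, hx g.2⟩ v

/-- This compatibility with `N_G(P) ∩ ˣH` makes `n ⊗ [v] ↦ n [x ⊗ v]` well defined on the induced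
module. -/
theorem brauerIndMk_equivariant
    (n : (conjSubgroup x H).subgroupOf (Subgroup.normalizer (P : Set G))) (v) :
    brauerRep (Representation.ind H.subtype ρ) P n (brauerIndMk ρ hx v) =
      brauerIndMk ρ hx (conjBrauerRep P H x ρ n v) := by
  obtain ⟨v, rfl⟩ := Submodule.Quotient.mk_surjective _ v
  change Submodule.Quotient.mk _ = Submodule.Quotient.mk _
  congr 1
  apply Subtype.ext
  exact ind_indMk_conj H x ρ ⟨((n : Subgroup.normalizer (P : Set G)) : G), n.2⟩ v

/-- The map `Ind_{N_G(P) ∩ ˣH}^{N_G(P)} ((ˣV)(P)) → (Ind_H^G V)(P)`, `n ⊗ [v] ↦ n [x ⊗ v]`. -/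
def mackeyTermMap :
    Representation.IndV ((conjSubgroup x H).subgroupOf (Subgroup.normalizer (P : Set G))).subtype
      (conjBrauerRep P H x ρ) →ₗ[k]
      (fixed (Representation.ind H.subtype ρ) P ⧸ traceSum (Representation.ind H.subtype ρ) P) :=
  indLift (conjBrauerRep P H x ρ)
    (fun n => brauerRep (Representation.ind H.subtype ρ) P n ∘ₗ brauerIndMk ρ hx)
    (fun n h v => by
      simp only [LinearMap.comp_apply]
      rw [← brauerIndMk_equivariant, map_mul, Module.End.mul_apply])

theorem mackeyTermMap_indMk (n : Subgroup.normalizer (P : Set G))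
    (v : fixed (conjRep H x ρ) (P.subgroupOf (conjSubgroup x H)) ⧸
      traceSum (conjRep H x ρ) (P.subgroupOf (conjSubgroup x H))) :
    mackeyTermMap ρ hx (indMk (conjBrauerRep P H x ρ) n v) =
      brauerRep (Representation.ind H.subtype ρ) P n (brauerIndMk ρ hx v) := by
  rw [mackeyTermMap, indLift_indMk, LinearMap.comp_apply]

theorem mackeyTermMap_ind (n : Subgroup.normalizer (P : Set G)) (z) :
    mackeyTermMap ρ hx (Representation.ind
      ((conjSubgroup x H).subgroupOf (Subgroup.normalizer (P : Set G))).subtype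
      (conjBrauerRep P H x ρ) n z) =
      brauerRep (Representation.ind H.subtype ρ) P n (mackeyTermMap ρ hx z) := by
  revert z
  refine LinearMap.congr_fun (f := mackeyTermMap ρ hx ∘ₗ Representation.ind
    ((conjSubgroup x H).subgroupOf (Subgroup.normalizer (P : Set G))).subtype
    (conjBrauerRep P H x ρ) n)
    (g := brauerRep (Representation.ind H.subtype ρ) P n ∘ₗ mackeyTermMap ρ hx) ?_
  refine ind_hom_ext _ fun m => LinearMap.ext fun v => ?_
  simp only [LinearMap.comp_apply]
  rw [ind_indMk, mackeyTermMap_indMk, mackeyTermMap_indMk, map_mul, Module.End.mul_apply]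

/-- On `z = m ⊗ [v]` the left side is the coefficient at `x` of `n⁻¹ m x ⊗ v`. It vanishes unless
`x⁻¹ n⁻¹ m x ∈ H`, that is `n⁻¹ m ∈ ˣH`, which is the condition governing `indEval _ n (m ⊗ [v])`.
-/
theorem brauerIndEval_mackeyTermMap (n : Subgroup.normalizer (P : Set G)) (z) :
    brauerIndEval ρ hx (brauerRep (Representation.ind H.subtype ρ) P n⁻¹
      (mackeyTermMap ρ hx z)) = indEval _ n z := by
  revert z
  refine LinearMap.congr_fun (f := brauerIndEval ρ hx ∘ₗ
    brauerRep (Representation.ind H.subtype ρ) P n⁻¹ ∘ₗ mackeyTermMap ρ hx) ?_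
  refine ind_hom_ext _ fun m => LinearMap.ext fun v => ?_
  obtain ⟨v, rfl⟩ := Submodule.Quotient.mk_surjective _ v
  simp only [LinearMap.comp_apply, mackeyTermMap_indMk]
  rw [← Module.End.mul_apply, ← map_mul]
  -- All three maps are induced from maps on fixed points, so the composite can be computed on the
  -- representative `v`.
  have hv : brauerIndEval ρ hx (brauerRep (Representation.ind H.subtype ρ) P (n⁻¹ * m)
      (brauerIndMk ρ hx (Submodule.Quotient.mk v))) = Submodule.Quotient.mk
      ⟨indEval ρ x (Representation.ind H.subtype ρ ((n⁻¹ * m : Subgroup.normalizer (P : Set G)) : G)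
        (indMk ρ x v)), semilinear_mem_fixed _ _ _ _ (Subgroup.subgroupOfEquivOfLe hx).symm
          (indEval ρ x) (fun g v => indEval_ind_conj H x ρ ⟨g, hx g.2⟩ v) _
          (fixedRep (Representation.ind H.subtype ρ) P (n⁻¹ * m) ⟨indMk ρ x v,
            semilinear_mem_fixed _ _ _ _ (Subgroup.subgroupOfEquivOfLe hx) (indMk ρ x)
              (fun g v => (ind_indMk_conj H x ρ g v).symm) _ v.2⟩).2⟩ := rfl
  rw [hv]
  by_cases h : n⁻¹ * m ∈ (conjSubgroup x H).subgroupOf (Subgroup.normalizer (P : Set G))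
  · rw [indEval_indMk_of_mem _ h]
    change _ = Submodule.Quotient.mk _
    congr 1
    apply Subtype.ext
    change indEval ρ x (Representation.ind H.subtype ρ _ (indMk ρ x (v : V))) =
      conjRep H x ρ ⟨((n⁻¹ * m : Subgroup.normalizer (P : Set G)) : G), h⟩ (v : V)
    rw [← indEval_indMk ρ x (conjRep H x ρ _ _), ← ind_indMk_conj]
  · rw [indEval_indMk_of_notMem _ h]
    refine (Submodule.Quotient.mk_eq_zero _).2 ?_
    refine (congrArg (· ∈ _) (Subtype.ext ?_)).mpr (Submodule.zero_mem _)
    change indEval ρ x (Representation.ind H.subtype ρ _ (indMk ρ x (v : V))) = 0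
    rw [ind_indMk, indEval_indMk_of_notMem]
    intro h'
    apply h
    rw [Subgroup.mem_subgroupOf]
    refine ⟨_, h', ?_⟩
    simp [mul_assoc]

/-- A nonzero coefficient at `x` of `n⁻¹ m y ⊗ v` would need `x⁻¹ n⁻¹ m y ∈ H`, putting `x` and `y`
in the same double coset. -/
theorem brauerIndEval_mackeyTermMap_of_ne {y : G} (hy : P ≤ conjSubgroup y H)
    (hxy : DoubleCoset.mk (Subgroup.normalizer (P : Set G)) H x ≠
      DoubleCoset.mk (Subgroup.normalizer (P : Set G)) H y)
    (n : Subgroup.normalizer (P : Set G)) (z) :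
    brauerIndEval ρ hx (brauerRep (Representation.ind H.subtype ρ) P n⁻¹
      (mackeyTermMap ρ hy z)) = 0 := by
  revert z
  refine LinearMap.congr_fun (f := brauerIndEval ρ hx ∘ₗ
    brauerRep (Representation.ind H.subtype ρ) P n⁻¹ ∘ₗ mackeyTermMap ρ hy)
    (g := 0) ?_
  refine ind_hom_ext _ fun m => LinearMap.ext fun v => ?_
  obtain ⟨v, rfl⟩ := Submodule.Quotient.mk_surjective _ v
  simp only [LinearMap.comp_apply, mackeyTermMap_indMk, LinearMap.zero_apply]
  rw [← Module.End.mul_apply, ← map_mul]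
  refine (Submodule.Quotient.mk_eq_zero _).2 ?_
  refine (congrArg (· ∈ _) (Subtype.ext ?_)).mpr (Submodule.zero_mem _)
  change indEval ρ x (Representation.ind H.subtype ρ _ (indMk ρ y (v : V))) = 0
  rw [ind_indMk, indEval_indMk_of_notMem]
  intro h
  apply hxy
  rw [DoubleCoset.eq]
  refine ⟨_, (m⁻¹ * n).2, _, h, ?_⟩
  simp [mul_assoc]

/-- The hypothesis says that `v` is concentrated in the summand at `xH`; this is how classes are
shown to lie in the image. -/
theorem mk_eq_brauerIndMk (v : fixed (Representation.ind H.subtype ρ) P)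
    (hv : indMk ρ x (indEval ρ x v) = v) :
    Submodule.Quotient.mk v = brauerIndMk ρ hx (brauerIndEval ρ hx (Submodule.Quotient.mk v)) := by
  change _ = Submodule.Quotient.mk _
  congr 1
  exact Subtype.ext hv.symm

end Mackey

/-! ### Bijectivity of the map from the sum over double cosets -/

section MackeySum

variable {k : Type u} {G : Type v} [CommRing k] [Group G] [Finite G] {P H : Subgroup G}
  (s : NDoset P H → G) {V : Type w} [AddCommGroup V] [Module k V] (ρ : Representation k H V)

/-- The direct sum over double cosets of the Mackey terms of a representation. -/
abbrev mackeySumRep : Representation k (Subgroup.normalizer (P : Set G))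
    (DirectSum {q : NDoset P H // P ≤ conjSubgroup (s q) H} fun q =>
      Representation.IndV ((conjSubgroup (s q) H).subgroupOf
        (Subgroup.normalizer (P : Set G))).subtype (conjBrauerRep P H (s q) ρ)) :=
  Representation.directSum fun q : {q : NDoset P H // P ≤ conjSubgroup (s q) H} =>
    Representation.ind ((conjSubgroup (s q) H).subgroupOf
      (Subgroup.normalizer (P : Set G))).subtype (conjBrauerRep P H (s q) ρ)

open Classical in
/-- The map from the Mackey sum to `(Ind_H^G V)(P)`. -/
def mackeySumHom : (mackeySumRep s ρ).IntertwiningMap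
    (brauerRep (Representation.ind H.subtype ρ) P) where
  toLinearMap := DirectSum.toModule k _ _ fun q => mackeyTermMap ρ q.2
  isIntertwining' n := by
    ext q : 1
    refine LinearMap.ext fun z => ?_
    simp only [LinearMap.comp_apply, Representation.directSum_apply, DirectSum.lmap_lof,
      DirectSum.toModule_lof]
    exact mackeyTermMap_ind ρ q.2 n z

open Classical in
theorem mackeySumHom_lof (q : {q : NDoset P H // P ≤ conjSubgroup (s q) H}) (z) :
    (mackeySumHom s ρ).toLinearMap (DirectSum.lof k _ _ q z) = mackeyTermMap ρ q.2 z :=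
  DirectSum.toModule_lof _ _ _

variable (hs : ∀ q, DoubleCoset.mk (Subgroup.normalizer (P : Set G)) H (s q) = q)

include hs

theorem brauerIndEval_mackeySumHom (q : {q : NDoset P H // P ≤ conjSubgroup (s q) H})
    (n : Subgroup.normalizer (P : Set G))
    (z : DirectSum _ fun q : {q : NDoset P H // P ≤ conjSubgroup (s q) H} =>
      Representation.IndV ((conjSubgroup (s q) H).subgroupOf
        (Subgroup.normalizer (P : Set G))).subtype (conjBrauerRep P H (s q) ρ)) :
    brauerIndEval ρ q.2 (brauerRep (Representation.ind H.subtype ρ) P n⁻¹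
      ((mackeySumHom s ρ).toLinearMap z)) = indEval _ n (z q) := by
  classical
  revert z
  refine LinearMap.congr_fun (f := brauerIndEval ρ q.2 ∘ₗ
    brauerRep (Representation.ind H.subtype ρ) P n⁻¹ ∘ₗ (mackeySumHom s ρ).toLinearMap)
    (g := indEval (conjBrauerRep P H (s q) ρ) n ∘ₗ DirectSum.component k _ _ q) ?_
  ext q' : 1
  refine LinearMap.ext fun z => ?_
  simp only [LinearMap.comp_apply, mackeySumHom_lof]
  by_cases h : q' = q
  · subst h
    rw [brauerIndEval_mackeyTermMap, DirectSum.component.lof_self]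
  · rw [brauerIndEval_mackeyTermMap_of_ne, DirectSum.component.of, dif_neg h, map_zero]
    rw [hs, hs]
    exact fun h' => h (Subtype.ext h'.symm)

/-- Each component `z q` is rebuilt from its coefficients, and each coefficient is a function of the
image of `z`. -/
theorem mackeySumHom_injective : Function.Injective (mackeySumHom s ρ).toLinearMap := by
  rw [injective_iff_map_eq_zero]
  intro z hz
  ext q
  have := Fintype.ofFinite (Subgroup.normalizer (P : Set G) ⧸
    (conjSubgroup (s q) H).subgroupOf (Subgroup.normalizer (P : Set G)))
  rw [← sum_indMk_indEval _ Quotient.out (fun c => Quotient.out_eq c) (z q)]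
  refine (Finset.sum_eq_zero fun c _ => ?_).trans rfl
  rw [← brauerIndEval_mackeySumHom s ρ hs, hz]
  simp

/-- By `mem_of_fixed_components` it suffices to reach a component at a coset fixed by `P`. An
element of `N_G(P)` moves that coset to `s q H`, where the class comes from the generator `1 ⊗ [·]`;
equivariance moves it back. -/
theorem mackeySumHom_surjective : Function.Surjective (mackeySumHom s ρ).toLinearMap := by
  classical
  intro v
  obtain ⟨v, rfl⟩ := Submodule.Quotient.mk_surjective _ v
  let R := (LinearMap.range (mackeySumHom s ρ).toLinearMap).comap (Submodule.mkQ _)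
  change v ∈ R
  have := Fintype.ofFinite (G ⧸ H)
  refine mem_of_fixed_components (X := G ⧸ H) (Representation.ind H.subtype ρ) P
    (fun c v => indMk ρ c.out (indEval ρ c.out v)) ?_ ?_ R ?_ v ?_
  · intro g c v
    have h : ((g * c.out : G) : G ⧸ H) = ((g • c).out : G) := by
      rw [QuotientGroup.out_eq', ← smul_eq_mul, MulAction.Quotient.coe_smul_out]
      rfl
    rw [ind_indMk, ← indMk_indEval_congr ρ h, indEval_ind, inv_mul_cancel_left]
  · intro v
    rw [finsum_eq_sum_of_fintype]
    exact sum_indMk_indEval ρ _ (fun c => Quotient.out_eq c) v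
  · intro v hv
    change Submodule.Quotient.mk v ∈ LinearMap.range (mackeySumHom s ρ).toLinearMap
    rw [(Submodule.Quotient.mk_eq_zero _).2 hv]
    exact Submodule.zero_mem _
  · intro c hc hv
    let q := DoubleCoset.mk (Subgroup.normalizer (P : Set G)) H c.out
    obtain ⟨n, hn, h, hh, hnh⟩ := (DoubleCoset.eq _ _ _ _).1 (hs q)
    -- Here `c = n (s q) H`. As `n g n⁻¹ ∈ P` fixes `c`, the element `g` fixes `(s q) H`.
    have hq : P ≤ conjSubgroup (s q) H := by
      intro g hg
      have h1 := hc ⟨n * g * n⁻¹, (Subgroup.mem_set_normalizer_iff.1 hn g).1 hg⟩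
      change (n * g * n⁻¹) • c = c at h1
      rw [← QuotientGroup.out_eq' c, MulAction.Quotient.smul_coe] at h1
      have h2 := QuotientGroup.eq.1 h1.symm
      rw [smul_eq_mul, hnh] at h2
      have h3 : h⁻¹ * ((s q)⁻¹ * g * s q) * h ∈ H := by
        convert h2 using 1
        group
      have h4 := (H.mul_mem_cancel_left (H.inv_mem hh)).1 ((H.mul_mem_cancel_right hh).1 h3)
      exact ⟨_, h4, by simp [mul_assoc]⟩
    let n' : Subgroup.normalizer (P : Set G) := ⟨n, hn⟩
    let u := indEval ρ c.out v
    let w := fixedRep (Representation.ind H.subtype ρ) P n'⁻¹ ⟨_, hv⟩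
    have hw : (w : Representation.IndV H.subtype ρ) = indMk ρ (s q) (ρ ⟨h, hh⟩ u) := by
      change Representation.ind H.subtype ρ n⁻¹ (indMk ρ c.out u) = _
      rw [ind_indMk, ← indMk_mul, hnh]
      congr 2
      group
    have hw' := mk_eq_brauerIndMk ρ hq w (by rw [hw, indEval_indMk])
    have hmem : Submodule.Quotient.mk w ∈ LinearMap.range (mackeySumHom s ρ).toLinearMap := by
      rw [hw']
      refine ⟨DirectSum.lof k _ _ ⟨q, hq⟩ (indMk _ 1
        (brauerIndEval ρ hq (Submodule.Quotient.mk w))), ?_⟩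
      rw [mackeySumHom_lof, mackeyTermMap_indMk, map_one]
      rfl
    obtain ⟨z, hz⟩ := hmem
    refine ⟨mackeySumRep s ρ n' z, ?_⟩
    refine (LinearMap.congr_fun ((mackeySumHom s ρ).isIntertwining' n') z).trans ?_
    rw [LinearMap.comp_apply, hz]
    change Submodule.Quotient.mk (fixedRep (Representation.ind H.subtype ρ) P n' w) = _
    rw [← Module.End.mul_apply, ← map_mul, mul_inv_cancel, map_one]
    rfl

end MackeySum

/-! ### Naturality in the module -/

section NaturalIso

variable {k : Type u} {G : Type v} [CommRing k] [Group G] [Finite G] {P H : Subgroup G}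
  (s : NDoset P H → G) (hs : ∀ q, DoubleCoset.mk (Subgroup.normalizer (P : Set G)) H (s q) = q)

/-- The isomorphism `⨁_x Ind_{N_G(P) ∩ ˣH}^{N_G(P)} ((ˣM)(P)) ≅ (Ind_H^G M)(P)`. -/
def mackeySumIso (M : Rep.{w} k H) :
    (mackeySum k P H s).obj M ≅ (Rep.indFunctor k H.subtype ⋙ brauerFunctor P).obj M :=
  Rep.mkIso (Representation.IntertwiningMap.ofBijective (mackeySumHom s M.ρ)
    ⟨mackeySumHom_injective s M.ρ hs, mackeySumHom_surjective s M.ρ hs⟩)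

theorem mackeyTermMap_naturality {x : G} (hx : P ≤ conjSubgroup x H) {M N : Rep.{w} k H}
    (f : M ⟶ N) (z : ((mackeyTerm k P H x).obj M).V) :
    mackeyTermMap N.ρ hx (((mackeyTerm k P H x).map f).hom z) =
      ((brauerFunctor P).map ((Rep.indFunctor k H.subtype).map f)).hom (mackeyTermMap M.ρ hx z) := by
  revert z
  refine LinearMap.congr_fun
    (f := mackeyTermMap N.ρ hx ∘ₗ ((mackeyTerm k P H x).map f).hom.toLinearMap)
    (g := ((brauerFunctor P).map ((Rep.indFunctor k H.subtype).map f)).hom.toLinearMap ∘ₗ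
      mackeyTermMap M.ρ hx) ?_
  refine ind_hom_ext _ fun n => LinearMap.ext fun v => ?_
  obtain ⟨v, rfl⟩ := Submodule.Quotient.mk_surjective _ v
  refine (mackeyTermMap_indMk N.ρ hx n (((brauerFunctor _).map
    ((conjFunctor k x H).map f)).hom (Submodule.Quotient.mk v))).trans ?_
  exact congrArg ((brauerFunctor P).map ((Rep.indFunctor k H.subtype).map f)).hom
    (mackeyTermMap_indMk M.ρ hx n (Submodule.Quotient.mk v)).symm

theorem mackeySumIso_naturality {M N : Rep.{w} k H} (f : M ⟶ N) :
    (mackeySum k P H s).map f ≫ (mackeySumIso s hs N).hom =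
      (mackeySumIso s hs M).hom ≫ (Rep.indFunctor k H.subtype ⋙ brauerFunctor P).map f := by
  classical
  apply Rep.hom_ext
  apply Representation.IntertwiningMap.ext
  refine DirectSum.linearMap_ext k fun q => LinearMap.ext fun z => ?_
  change (mackeySumHom s N.ρ).toLinearMap (DirectSum.lmap
      (fun q : {q : NDoset P H // P ≤ conjSubgroup (s q) H} =>
        ((mackeyTerm k P H (s q)).map f).hom.toLinearMap) (DirectSum.lof k _ _ q z)) =
    ((brauerFunctor P).map ((Rep.indFunctor k H.subtype).map f)).hom
      ((mackeySumHom s M.ρ).toLinearMap (DirectSum.lof k _ _ q z))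
  rw [DirectSum.lmap_lof]
  refine (mackeySumHom_lof s N.ρ q _).trans ?_
  refine (mackeyTermMap_naturality q.2 f z).trans ?_
  exact congrArg _ (mackeySumHom_lof s M.ρ q z).symm

/-- The Brauer construction of induced modules: a natural isomorphism on all `kH`-modules. -/
def brauerIndIso : Rep.indFunctor.{w} k H.subtype ⋙ brauerFunctor P ≅ mackeySum k P H s :=
  (NatIso.ofComponents (mackeySumIso s hs) fun f => mackeySumIso_naturality s hs f).symm

end NaturalIso

/-! ### Induction and the Brauer construction preserve `p`-permutation modules -/

section PPermutation

variable {p : ℕ} {k : Type u} [CommRing k] {G : Type v} [Group G]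

theorem isPPerm_of_iso {M N : Rep.{w} k G} (e : M ≅ N) (hM : isPPerm p k G M) :
    isPPerm p k G N := by
  intro Q hQ
  obtain ⟨n, b, hb⟩ := hM Q hQ
  let E := (Representation.equivOfIso e).toLinearEquiv
  refine ⟨n, b.map E, fun g hg i => ?_⟩
  obtain ⟨j, hj⟩ := hb g hg i
  refine ⟨j, ?_⟩
  rw [Module.Basis.map_apply, Module.Basis.map_apply, ← hj]
  exact (Rep.hom_comm_apply e.hom g (b i)).symm

theorem isPPerm_of_finite_basis {M : Rep.{w} k G}
    (h : ∀ Q : Subgroup G, IsPGroup p Q → ∃ (ι : Type w') (_ : Finite ι)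
      (b : Module.Basis ι k M.V), ∀ g ∈ Q, ∀ i, ∃ j, M.ρ g (b i) = b j) : isPPerm p k G M := by
  intro Q hQ
  obtain ⟨ι, _, b, hb⟩ := h Q hQ
  have := Fintype.ofFinite ι
  refine ⟨Fintype.card ι, b.reindex (Fintype.equivFin ι), fun g hg i => ?_⟩
  obtain ⟨j, hj⟩ := hb g hg ((Fintype.equivFin ι).symm i)
  exact ⟨Fintype.equivFin ι j, by simpa using hj⟩

/-- For each `Q`-orbit on `G/H` with representative `yH`, take a basis of `M` permuted by the
`p`-group `H ∩ y⁻¹Qy` and spread it along the orbit by elements of `Q`. -/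
theorem isPPerm_ind [Finite G] (H : Subgroup G) (M : Rep.{w} k H) (hM : isPPerm p k H M) :
    isPPerm p k G ((Rep.indFunctor k H.subtype).obj M) := by
  classical
  refine isPPerm_of_finite_basis fun Q hQ => ?_
  have := Fintype.ofFinite (G ⧸ H)
  let o : G ⧸ H → MulAction.orbitRel.Quotient Q (G ⧸ H) := Quotient.mk _
  have ho : ∀ (g : Q) (c : G ⧸ H), o (g • c) = o c := fun g c => Quotient.sound ⟨g, rfl⟩
  have hr : ∀ c : G ⧸ H, ∃ g : Q, g • (o c).out = c := fun c =>
    Quotient.exact (Quotient.out_eq (o c)).symm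
  choose γ hγ using hr
  let y : MulAction.orbitRel.Quotient Q (G ⧸ H) → G := fun a => a.out.out
  -- With representatives in `Q y`, the element `h = (t (g • c))⁻¹ g (t c)` of `H` satisfies `y h
  -- y⁻¹ ∈ Q`, so `h` permutes the basis chosen for the orbit.
  let t : G ⧸ H → G := fun c => γ c * y (o c)
  have ht : ∀ c, (t c : G ⧸ H) = c := fun c => by
    conv_rhs => rw [← hγ c, ← QuotientGroup.out_eq' (o c).out]
    rfl
  have hS : ∀ a, ∃ (n : ℕ) (b : Module.Basis (Fin n) k M.V),
      ∀ h : H, y a * h * (y a)⁻¹ ∈ Q → ∀ i, ∃ j, M.ρ h (b i) = b j := fun a => by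
    obtain ⟨n, b, hb⟩ := hM (Q.comap ((MulAut.conj (y a)).toMonoidHom.comp H.subtype))
      (hQ.comap_of_injective _ ((MulAut.conj (y a)).injective.comp H.subtype_injective))
    exact ⟨n, b, fun h hh => hb h hh⟩
  choose n b hb using hS
  refine ⟨Σ c : G ⧸ H, Fin (n (o c)), inferInstance,
    (Pi.basis fun c => b (o c)).map (indEquivPi M.ρ t ht), fun g hg i => ?_⟩
  have hbasis : ∀ i, (Pi.basis fun c => b (o c)).map (indEquivPi M.ρ t ht) i =
      indMk M.ρ (t i.1) (b (o i.1) i.2) := fun i => by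
    rw [Module.Basis.map_apply, Pi.basis_apply, indEquivPi_single]
  obtain ⟨c, i⟩ := i
  let g' : Q := ⟨g, hg⟩
  have hh : (t (g' • c))⁻¹ * (g * t c) ∈ H := by
    rw [← QuotientGroup.eq, ht, ← smul_eq_mul, ← MulAction.Quotient.smul_coe, ht]
    rfl
  have hQ' : y (o c) * ((t (g' • c))⁻¹ * (g * t c)) * (y (o c))⁻¹ ∈ Q := by
    have : y (o c) * ((t (g' • c))⁻¹ * (g * t c)) * (y (o c))⁻¹ =
        (γ (g' • c) : G)⁻¹ * (g * γ c) := by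
      simp only [t, ho]
      group
    rw [this]
    exact Q.mul_mem (Q.inv_mem (γ _).2) (Q.mul_mem hg (γ _).2)
  obtain ⟨j, hj⟩ := hb (o c) ⟨_, hh⟩ hQ' i
  obtain ⟨j', hj'⟩ : ∃ j', b (o (g' • c)) j' = b (o c) j := by
    rw [ho]
    exact ⟨j, rfl⟩
  refine ⟨⟨g' • c, j'⟩, ?_⟩
  rw [hbasis, hbasis, hj', ← hj, ← indMk_mul]
  refine (ind_indMk M.ρ g _ _).trans ?_
  simp

/-- The action on the index set of a basis permuted by a subgroup. -/
abbrev basisAction [Nontrivial k] {V : Type w} [AddCommGroup V] [Module k V]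
    (ρ : Representation k G V) (P : Subgroup G) {ι : Type w'} (b : Module.Basis ι k V)
    (π : P → ι → ι) (hπ : ∀ (g : P) (i : ι), ρ g (b i) = b (π g i)) : MulAction P ι where
  smul := π
  one_smul i := b.injective ((hπ 1 i).symm.trans (by simp))
  mul_smul g h i := b.injective (by
    change b (π (g * h) i) = b (π g (π h i))
    rw [← hπ, ← hπ, ← hπ]
    simp)

theorem coord_smul [Nontrivial k] {V : Type w} [AddCommGroup V] [Module k V]
    (ρ : Representation k G V) (P : Subgroup G) {ι : Type w'} (b : Module.Basis ι k V)
    [MulAction P ι] (hb : ∀ (g : P) (i : ι), ρ g (b i) = b (g • i)) (g : P) (i : ι) (v : V) :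
    b.coord (g • i) (ρ g v) = b.coord i v := by
  classical
  revert v
  refine LinearMap.congr_fun (f := b.coord (g • i) ∘ₗ ρ g) (b.ext fun j => ?_)
  rw [LinearMap.comp_apply, hb]
  simp [Finsupp.single_apply]

/-- At a fixed index every translate `g v` has the same coordinate as `v`, so the trace from `Q < P`
has `[P : Q]` times that coordinate. This index is a positive power of `p`, hence zero in `k`. -/
theorem coord_traceSum [Fact p.Prime] [CharP k p] [Nontrivial k] [Finite G]
    {V : Type w} [AddCommGroup V] [Module k V]
    (ρ : Representation k G V) (P : Subgroup G) (hP : IsPGroup p P) {ι : Type w'}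
    (b : Module.Basis ι k V) [MulAction P ι] (hb : ∀ (g : P) (i : ι), ρ g (b i) = b (g • i))
    (i : ι) (hi : i ∈ MulAction.fixedPoints P ι) :
    traceSum ρ P ≤ LinearMap.ker (b.coord i ∘ₗ (fixed ρ P).subtype) := by
  refine iSup₂_le fun Q hQ => ?_
  rintro _ ⟨v, rfl⟩
  rw [LinearMap.mem_ker]
  change b.coord i (cosetSum ρ Q P v) = 0
  have := Fintype.ofFinite (P ⧸ Q.subgroupOf P)
  rw [cosetSum_apply, finsum_eq_sum_of_fintype, map_sum]
  have h : ∀ g : P, b.coord i (ρ g v) = b.coord i v := fun g => by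
    conv_lhs => rw [← hi g]
    exact coord_smul ρ P b hb g i v
  simp only [h, Finset.sum_const, Finset.card_univ]
  obtain ⟨n, hn⟩ := hP.index (Q.subgroupOf P)
  have hn0 : n ≠ 0 := by
    rintro rfl
    rw [pow_zero, Subgroup.index_eq_one, Subgroup.subgroupOf_eq_top] at hn
    exact hQ.not_ge hn
  rw [← Nat.card_eq_fintype_card, ← Subgroup.index, hn, ← Nat.cast_smul_eq_nsmul k, Nat.cast_pow,
    CharP.cast_eq_zero, zero_pow hn0, zero_smul]

/-- The classes of the `P`-fixed basis vectors form a basis of `V(P)`: coordinates at fixed indices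
descend by `coord_traceSum` and give independence, and `mem_of_fixed_components` gives spanning.
Elements of `N_G(P)` preserve `P`-fixedness. -/
theorem isPPerm_brauer [Fact p.Prime] [CharP k p] [Finite G] (P : Subgroup G) (hP : IsPGroup p P)
    (M : Rep.{w} k G) (hM : isPPerm p k G M) :
    isPPerm p k (Subgroup.normalizer (P : Set G)) ((brauerFunctor P).obj M) := by
  classical
  have := CharP.nontrivial_of_char_ne_one (R := k) (Fact.out : p.Prime).ne_one
  refine isPPerm_of_finite_basis fun Q hQ => ?_
  let Q' : Subgroup G := Q.map (Subgroup.normalizer (P : Set G)).subtype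
  -- One basis must be permuted by both `P` and `Q`. As `Q` normalizes `P`, their join is a
  -- `p`-group and supplies it.
  have hQ' : IsPGroup p (P ⊔ Q' : Subgroup G) :=
    IsPGroup.to_sup_of_normal_left' hP (hQ.map _) (Subgroup.map_subtype_le _)
  obtain ⟨n, b, hb⟩ := hM _ hQ'
  choose π hπ using fun (g : P) i => hb g (le_sup_left (a := P) (b := Q') g.2) i
  let := basisAction M.ρ P b π hπ
  let I := {i // b i ∈ fixed M.ρ P}
  have hI : ∀ i, b i ∈ fixed M.ρ P ↔ i ∈ MulAction.fixedPoints P (Fin n) := fun i => by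
    rw [mem_fixed]
    refine ⟨fun h g => b.injective ((hπ g i).symm.trans (h g g.2)), fun h g hg => ?_⟩
    exact (hπ ⟨g, hg⟩ i).trans (congrArg b (h ⟨g, hg⟩))
  let β : I → fixed M.ρ P ⧸ traceSum M.ρ P := fun i => Submodule.Quotient.mk ⟨b i, i.2⟩
  let φ : I → (fixed M.ρ P ⧸ traceSum M.ρ P) →ₗ[k] k := fun i =>
    (traceSum M.ρ P).liftQ (b.coord i ∘ₗ (fixed M.ρ P).subtype)
      (coord_traceSum M.ρ P hP b hπ i ((hI i).1 i.2))
  have hφ : ∀ i j, φ i (β j) = if j = i then 1 else 0 := fun i j => by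
    change b.coord i (b j) = _
    simp only [Module.Basis.coord_apply, Module.Basis.repr_self, Finsupp.single_apply]
    exact if_congr Subtype.ext_iff.symm rfl rfl
  have : Fintype I := Fintype.ofFinite I
  have hli : LinearIndependent k β := by
    rw [Fintype.linearIndependent_iff]
    intro c hc i
    have := congrArg (φ i) hc
    rw [map_sum, map_zero] at this
    simp only [map_smul, hφ, smul_eq_mul, mul_ite, mul_one, mul_zero] at this
    rwa [Finset.sum_eq_single i (fun j _ h => if_neg h) (by simp), if_pos rfl] at this
  have hsp : ⊤ ≤ Submodule.span k (Set.range β) := by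
    rintro v -
    obtain ⟨v, rfl⟩ := Submodule.Quotient.mk_surjective _ v
    refine mem_of_fixed_components M.ρ P (fun i v => b.coord i v • b i) ?_ ?_
      ((Submodule.span k (Set.range β)).comap (traceSum M.ρ P).mkQ) ?_ v ?_
    · intro g i v
      rw [coord_smul M.ρ P b hπ, map_smul, hπ]
      rfl
    · intro v
      rw [finsum_eq_sum_of_fintype]
      exact b.sum_repr v
    · intro v hv
      change Submodule.Quotient.mk v ∈ Submodule.span k (Set.range β)
      rw [(Submodule.Quotient.mk_eq_zero _).2 hv]
      exact Submodule.zero_mem _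
    · intro i hi hv
      exact Submodule.smul_mem _ (b.coord i v)
        (Submodule.subset_span (Set.mem_range_self (⟨i, (hI i).2 hi⟩ : I)))
  refine ⟨I, inferInstance, Module.Basis.mk hli hsp, fun g hg i => ?_⟩
  obtain ⟨j, hj⟩ := hb g (le_sup_right (a := P) (b := Q') (Subgroup.mem_map_of_mem _ hg)) i
  have hjf : b j ∈ fixed M.ρ P := by
    rw [← hj]
    exact (fixedRep M.ρ P g ⟨b i, i.2⟩).2
  refine ⟨⟨j, hjf⟩, ?_⟩
  refine (congrArg (brauerRep M.ρ P g) (Module.Basis.mk_apply hli hsp i)).trans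
    (Eq.trans ?_ (Module.Basis.mk_apply hli hsp ⟨j, hjf⟩).symm)
  exact congrArg Submodule.Quotient.mk (Subtype.ext hj)

end PPermutation

end BrauerInd

end

/-! ### The isomorphism on `p`-permutation modules and on bounded complexes -/

theorem mainTheorem9 {p : ℕ} [Fact p.Prime] {k : Type u} [Field k] [CharP k p]
    {G : Type v} [Group G] [Finite G] (P H : Subgroup G) (hP : IsPGroup p P)
    (s : NDoset P H → G)
    (hs : ∀ q, DoubleCoset.mk (Subgroup.normalizer (P : Set G)) H (s q) = q) :
    ∃ (hInd : ∀ M : Rep.{w} k H, isPPerm p k H M →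
        isPPerm p k G ((Rep.indFunctor k H.subtype).obj M))
      (hBr : ∀ M : Rep.{max w u v} k G, isPPerm p k G M →
        isPPerm p k (Subgroup.normalizer (P : Set G)) ((brauerFunctor P).obj M))
      (hSum : ∀ M : Rep.{w} k H, isPPerm p k H M →
        isPPerm p k (Subgroup.normalizer (P : Set G)) ((mackeySum k P H s).obj M))
      (Φ : restrictTriv (Rep.indFunctor k H.subtype) hInd ⋙ restrictTriv (brauerFunctor P) hBr ≅
        restrictTriv (mackeySum k P H s) hSum)
      (Ψ : mapChb (restrictTriv (Rep.indFunctor k H.subtype) hInd) ⋙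
          mapChb (restrictTriv (brauerFunctor P) hBr) ≅
        mapChb (restrictTriv (mackeySum k P H s) hSum)),
      ∀ (C : Chb (Triv.{w} p k H)) (i : ℤ),
        (Ψ.hom.app C).hom.f i = Φ.hom.app (C.obj.X i) := by
  have hInd := isPPerm_ind.{w} (p := p) (k := k) H
  have hBr := isPPerm_brauer.{max w u v} (p := p) (k := k) P hP
  have hSum : ∀ M : Rep.{w} k H, isPPerm p k H M →
      isPPerm p k (Subgroup.normalizer (P : Set G)) ((mackeySum k P H s).obj M) := fun M hM =>
    -- The sum inherits the property through the isomorphism, so its terms need no separate check.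
    isPPerm_of_iso ((brauerIndIso s hs).app M) (hBr _ (hInd M hM))
  let Φ : restrictTriv (Rep.indFunctor k H.subtype) hInd ⋙ restrictTriv (brauerFunctor P) hBr ≅
      restrictTriv (mackeySum k P H s) hSum :=
    NatIso.ofComponents (fun M => ObjectProperty.isoMk _ ((brauerIndIso s hs).app M.obj))
      fun f => ObjectProperty.hom_ext _ ((brauerIndIso s hs).hom.naturality f.hom)
  let Ψ : mapChb (restrictTriv (Rep.indFunctor k H.subtype) hInd) ⋙
        mapChb (restrictTriv (brauerFunctor P) hBr) ≅
      mapChb (restrictTriv (mackeySum k P H s) hSum) :=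
    NatIso.ofComponents
      -- Naturality of `Φ` is used twice: at the differentials, for chain maps, and at the
      -- components of `f`, for naturality of `Ψ`.
      (fun C => ObjectProperty.isoMk _ (HomologicalComplex.Hom.isoOfComponents
        (fun i => Φ.app (C.obj.X i)) fun i j _ => (Φ.hom.naturality (C.obj.d i j)).symm))
      fun f => ObjectProperty.hom_ext _ (HomologicalComplex.hom_ext _ _ fun i =>
        Φ.hom.naturality (f.hom.f i))
  exact ⟨hInd, hBr, hSum, Φ, Ψ, fun C i => rfl⟩
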